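/- Let $A,\alpha$ be nonzero rational numbers and let $f:\mathbb T^2\to\mathbb T^2$, $\mathbb T^2=\mathbb R^2/\mathbb Z^2$, be the rational parabolic map which sends the point represented by $(x,y)\in[0,1)^2$ to $$\Big((1+A)x+\tfrac{A}{\alpha}y,\ -\alpha A x+(1-A)y\Big)\pmod 1 .$$ For $B\in\mathbb R$ let $L_B\subset\mathbb T^2$ be the projection to the torus of the line $y=B-\alpha x$, and for $p\in\mathbb T^2$ let $\omega(p)=\bigcap_{N\ge 0}\overline{\{f^n(p):n\ge N\}}$ be its $\omega$-limit set. Then: 1. for Lebesgue almost every $B\in\mathbb R$ and every $p\in L_B$, the set $\omega(p)$ is contained in $L_B$ and has positive one-dimensional Hausdorff measure; 2. for every $B$ in the countable set $\mathbb Q$ and every $p\in L_B$, the trajectory of $p$ is eventually periodic: there are $m\ge 0$ and $n\ge 1$ with $f^{m+n}(p)=f^m(p)$. -/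

import Mathlib

open MeasureTheory

namespace ParabolicTorus

/-- The torus `ℝ² / ℤ²`. -/
abbrev Torus : Type := UnitAddCircle × UnitAddCircle

/-- The representative in `[0, 1)` of a point of `ℝ / ℤ`. -/
noncomputable def rep (t : UnitAddCircle) : ℝ := (AddCircle.equivIco (1 : ℝ) 0 t : ℝ)

/-- The map of the torus which takes the point represented by `(x, y) ∈ [0, 1)²` to
`((1 + A) x + (A / α) y, -α A x + (1 - A) y)` modulo `1` in each coordinate. -/
noncomputable def parabolicMap (A α : ℝ) (p : Torus) : Torus :=
  ((((1 + A) * rep p.1 + A / α * rep p.2 : ℝ) : UnitAddCircle),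
    ((-(α * A) * rep p.1 + (1 - A) * rep p.2 : ℝ) : UnitAddCircle))

/-- The line `y = B - α x` of the plane, projected onto the torus. -/
def line (α B : ℝ) : Set Torus :=
  {p | ∃ t : ℝ, p = ((t : UnitAddCircle), ((B - α * t : ℝ) : UnitAddCircle))}

/-- The set of limit points of the forward trajectory of `p` under `f`. -/
def omegaLimitPt (f : Torus → Torus) (p : Torus) : Set Torus :=
  omegaLimit Filter.atTop (fun (n : ℕ) (z : Torus) => f^[n] z) {p}

/-- The one-dimensional (Hausdorff) measure of a subset of the torus, taken in the fundamental
square `[0, 1)²` with the Euclidean metric. -/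
noncomputable def length (S : Set Torus) : ENNReal :=
  Measure.hausdorffMeasure 1 {v : EuclideanSpace ℝ (Fin 2) |
    (∀ i, v i ∈ Set.Ico (0 : ℝ) 1) ∧ ((v 0 : UnitAddCircle), (v 1 : UnitAddCircle)) ∈ S}

/-- The forward trajectory of `p` under `f` is eventually periodic. -/
def EventuallyPeriodic (f : Torus → Torus) (p : Torus) : Prop :=
  ∃ m : ℕ, f^[m] p ∈ Function.periodicPts f

end ParabolicTorus

open Filter Topology

namespace ParabolicTorus

/-! In the parameter `t` of the line, the map is `t ↦ t + (A/α)B - A m - (A/α) n`, where the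
integers `m`, `n` depend on the point. Only this integer part makes the map discontinuous, and a
common denominator `D` of `A` and `A/α` kills it: on the line, `D • x` is carried to `D • x` plus
the constant `D(A/α)B` (`exists_nsmul_fst_semiconj`). For irrational `B` this is an irrational
rotation with dense forward orbits; compactness lifts each of its cluster points to the `ω`-limit
set, which `D • x` therefore maps onto the circle. For rational `B` a suitable multiple `E` kills
the whole displacement in both coordinates, so the orbit stays in one finite fibre of multiplication
by `E`. -/

theorem exists_int_rep_eq_sub (t : ℝ) : ∃ n : ℤ, rep (t : UnitAddCircle) = t - n :=
  ⟨⌊t⌋, by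
    have h := AddCircle.coe_equivIco_mk_apply (p := (1 : ℝ)) t
    rw [div_one, mul_one, Int.fract] at h
    exact h⟩

theorem coe_rep (x : UnitAddCircle) : ((rep x : ℝ) : UnitAddCircle) = x :=
  (AddCircle.equivIco (1 : ℝ) 0).symm_apply_apply x

theorem rep_mem_Ico (x : UnitAddCircle) : rep x ∈ Set.Ico (0 : ℝ) 1 := by
  have h : rep x ∈ Set.Ico (0 : ℝ) (0 + 1) := (AddCircle.equivIco (1 : ℝ) 0 x).2
  rwa [zero_add] at h

theorem coe_intCast_eq_zero (k : ℤ) : ((k : ℝ) : UnitAddCircle) = 0 :=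
  (AddCircle.coe_eq_zero_iff (1 : ℝ)).2 ⟨k, by simp⟩

theorem coe_sub_intCast (x : ℝ) (k : ℤ) : ((x - k : ℝ) : UnitAddCircle) = (x : UnitAddCircle) := by
  rw [AddCircle.coe_sub, coe_intCast_eq_zero, sub_zero]

theorem nsmul_coe_add_of_mul_eq_intCast {D : ℕ} {x y : ℝ} {k : ℤ} (h : (D : ℝ) * y = k) :
    D • ((x + y : ℝ) : UnitAddCircle) = D • (x : UnitAddCircle) := by
  rw [AddCircle.coe_add, smul_add, ← AddCircle.coe_nsmul (x := y), nsmul_eq_mul, h,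
    coe_intCast_eq_zero, add_zero]

theorem exists_common_denominator (s : Finset ℚ) :
    ∃ D : ℕ, 0 < D ∧ ∀ r ∈ s, ∃ k : ℤ, (D : ℝ) * r = k := by
  refine ⟨∏ r ∈ s, r.den, Finset.prod_pos fun r _ => r.den_pos, fun r hr => ?_⟩
  obtain ⟨c, hc⟩ := Finset.dvd_prod_of_mem Rat.den hr
  refine ⟨c * r.num, ?_⟩
  have h : (r.den : ℚ) * r = r.num := Rat.den_mul_eq_num r
  have h' : (r.den : ℝ) * r = r.num := by exact_mod_cast h
  rw [hc]
  push_cast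
  rw [← h']
  ring

/-- Along the line `y = B - α x` the parabolic map is a translation by one of countably many
numbers. -/
theorem parabolicMap_line_point {A α : ℝ} (hα : α ≠ 0) (B t : ℝ) :
    ∃ m n : ℤ, ∃ u : ℝ, u = t + A / α * (B - α * m - n) ∧
      parabolicMap A α ((t : UnitAddCircle), ((B - α * t : ℝ) : UnitAddCircle)) =
        ((u : UnitAddCircle), ((B - α * u : ℝ) : UnitAddCircle)) := by
  obtain ⟨m, hm⟩ := exists_int_rep_eq_sub t
  obtain ⟨n, hn⟩ := exists_int_rep_eq_sub (B - α * t)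
  refine ⟨m, n, _, rfl, ?_⟩
  unfold parabolicMap
  rw [hm, hn]
  refine congrArg₂ Prod.mk ?_ ?_
  · rw [← coe_sub_intCast (t + A / α * (B - α * m - n)) m]
    congr 1
    field_simp
    ring
  · rw [← coe_sub_intCast (B - α * (t + A / α * (B - α * m - n))) n]
    congr 1
    field_simp
    ring

theorem mapsTo_parabolicMap_line {A α : ℝ} (hα : α ≠ 0) (B : ℝ) :
    Set.MapsTo (parabolicMap A α) (line α B) (line α B) := by
  rintro _ ⟨t, rfl⟩
  obtain ⟨_, _, u, -, h⟩ := parabolicMap_line_point (A := A) hα B t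
  exact ⟨u, h⟩

/-- Since `α` is rational, the parametrization has period `α.den`: the second coordinate then
changes by the integer `α.num`. One compact period covers the line. -/
theorem isClosed_line (α : ℚ) (B : ℝ) : IsClosed (line α B) := by
  have hq : (0 : ℝ) < α.den := by exact_mod_cast α.den_pos
  have hα : (α : ℝ) * α.den = α.num := by exact_mod_cast Rat.mul_den_eq_num α
  have hcont : Continuous fun t : ℝ =>
      (((t : UnitAddCircle), ((B - α * t : ℝ) : UnitAddCircle)) : Torus) :=
    (AddCircle.continuous_mk' (1 : ℝ)).prodMk
      ((AddCircle.continuous_mk' (1 : ℝ)).comp (by fun_prop))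
  have himage : line α B = (fun t : ℝ =>
      (((t : UnitAddCircle), ((B - α * t : ℝ) : UnitAddCircle)) : Torus)) ''
        Set.Icc 0 (α.den : ℝ) := by
    refine Set.Subset.antisymm ?_ (by rintro _ ⟨t, -, rfl⟩; exact ⟨t, rfl⟩)
    rintro _ ⟨t, rfl⟩
    have h := Int.fract_nonneg (t / α.den)
    have h' := (Int.fract_lt_one (t / α.den)).le
    have e : (α.den : ℝ) * Int.fract (t / α.den) = t - ((α.den * ⌊t / α.den⌋ : ℤ) : ℝ) := by
      rw [Int.fract]
      push_cast
      field_simp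
    refine ⟨α.den * Int.fract (t / α.den), ⟨by positivity, mul_le_of_le_one_right hq.le h'⟩, ?_⟩
    refine Prod.ext ?_ ?_
    · simp only
      rw [e, coe_sub_intCast]
    · simp only
      rw [e, ← coe_sub_intCast (B - α * t) (-(α.num * ⌊t / α.den⌋))]
      congr 1
      push_cast
      rw [← hα]
      ring
  rw [himage]
  exact (isCompact_Icc.image hcont).isClosed

theorem mem_omegaLimitPt_iff {f : Torus → Torus} {p q : Torus} :
    q ∈ omegaLimitPt f p ↔ MapClusterPt q atTop fun n : ℕ => f^[n] p :=
  mem_omegaLimit_singleton_iff_mapClusterPt _ _ _ _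

theorem omegaLimitPt_subset_of_mapsTo {f : Torus → Torus} {S : Set Torus} (hS : IsClosed S)
    (hf : Set.MapsTo f S S) {p : Torus} (hp : p ∈ S) : omegaLimitPt f p ⊆ S := by
  intro q hq
  rw [mem_omegaLimitPt_iff, mapClusterPt_iff_ultrafilter] at hq
  obtain ⟨U, -, hU⟩ := hq
  exact hS.mem_of_tendsto hU (Eventually.of_forall fun n => hf.iterate n hp)

/-- A cluster point of the image of an orbit under a continuous map is the image of a point of the
`ω`-limit set, even if the dynamics is discontinuous. -/
theorem exists_mem_omegaLimitPt_of_mapClusterPt {Y : Type*} [TopologicalSpace Y] [T2Space Y]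
    {f : Torus → Torus} {g : Torus → Y} (hg : Continuous g) {p : Torus} {y : Y}
    (hy : MapClusterPt y atTop fun n : ℕ => g (f^[n] p)) :
    ∃ q ∈ omegaLimitPt f p, g q = y := by
  obtain ⟨U, hU, hUy⟩ := mapClusterPt_iff_ultrafilter.1 hy
  obtain ⟨q, hq⟩ : ∃ q, Tendsto (fun n : ℕ => f^[n] p) U (𝓝 q) := by
    obtain ⟨q, -, hq⟩ := isCompact_univ.ultrafilter_le_nhds
      (U.map fun n : ℕ => f^[n] p) (by simp)
    exact ⟨q, hq⟩
  exact ⟨q, mem_omegaLimitPt_iff.2 (mapClusterPt_iff_ultrafilter.2 ⟨U, hU, hq⟩),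
    tendsto_nhds_unique ((hg.tendsto q).comp hq) hUy⟩

theorem mapClusterPt_irrational_rotation {β : ℝ} (hβ : Irrational β) (x y : UnitAddCircle) :
    MapClusterPt y atTop fun n : ℕ => x + n • (β : UnitAddCircle) := by
  have hd : DenseRange fun n : ℤ => n • (β : UnitAddCircle) :=
    AddCircle.denseRange_zsmul_coe_iff.2 (by rwa [div_one])
  -- In a compact group, density of the integer multiples already makes every point a cluster point
  -- of the forward multiples.
  have h : MapClusterPt (y - x) atTop fun n : ℕ => n • (β : UnitAddCircle) :=
    ((mapClusterPt_atTop_nsmul_tfae _ _).out 0 3).2 (hd _)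
  have h' := h.continuousAt_comp (f := fun z => x + z) (by fun_prop)
  rwa [add_sub_cancel] at h'

/-- A subset of the torus whose first projection meets every fibre of multiplication by `D` has
positive length. -/
theorem length_pos_of_nsmul_fst_surjective {S : Set Torus} (D : ℕ) (hD : 0 < D)
    (hS : ∀ y : UnitAddCircle, ∃ q ∈ S, D • q.1 = y) : 0 < length S := by
  set V : Set (EuclideanSpace ℝ (Fin 2)) := {v | (∀ i, v i ∈ Set.Ico (0 : ℝ) 1) ∧
    ((v 0 : UnitAddCircle), (v 1 : UnitAddCircle)) ∈ S} with hV
  have hLip : LipschitzWith 1 fun v : EuclideanSpace ℝ (Fin 2) => v 0 :=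
    LipschitzWith.of_dist_le_mul fun v w => by
      rw [NNReal.coe_one, one_mul, dist_eq_norm, dist_eq_norm]
      exact PiLp.norm_apply_le (v - w) 0
  set X : Set ℝ := (fun v : EuclideanSpace ℝ (Fin 2) => v 0) '' V with hX
  have hle : volume X ≤ Measure.hausdorffMeasure 1 V := by
    have h := hLip.hausdorffMeasure_image_le zero_le_one V
    rwa [hausdorffMeasure_real, ENNReal.coe_one, ENNReal.one_rpow, one_mul] at h
  refine lt_of_lt_of_le (pos_iff_ne_zero.2 fun h0 => ?_) hle
  -- Countably many translates of the projection `X`, by multiples of `1/D`, cover the real line, so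
  -- `X` cannot be null.
  have hcover : (Set.univ : Set ℝ) ⊆ ⋃ k : ℤ, (fun x : ℝ => x + -(k / D : ℝ)) ⁻¹' X := by
    intro r _
    obtain ⟨q, hq, hqr⟩ := hS ((D * r : ℝ) : UnitAddCircle)
    have hmem : rep q.1 ∈ X := by
      refine ⟨!₂[rep q.1, rep q.2], ⟨?_, ?_⟩, rfl⟩
      · intro i
        fin_cases i
        · exact rep_mem_Ico q.1
        · exact rep_mem_Ico q.2
      · change (((rep q.1 : ℝ) : UnitAddCircle), ((rep q.2 : ℝ) : UnitAddCircle)) ∈ S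
        rwa [coe_rep, coe_rep]
    rw [← coe_rep q.1, ← AddCircle.coe_nsmul, nsmul_eq_mul, eq_comm, ← sub_eq_zero,
      ← AddCircle.coe_sub, AddCircle.coe_eq_zero_iff] at hqr
    obtain ⟨k, hk⟩ := hqr
    refine Set.mem_iUnion.2 ⟨k, ?_⟩
    have hD' : (D : ℝ) ≠ 0 := by positivity
    have e : r + -(k / D : ℝ) = rep q.1 := by
      rw [zsmul_eq_mul, mul_one] at hk
      rw [hk]
      field_simp
      ring
    rwa [Set.mem_preimage, e]
  have hnull : volume (Set.univ : Set ℝ) = 0 :=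
    measure_mono_null hcover (measure_iUnion_null fun k => by
      rw [measure_preimage_add_right, h0])
  simp at hnull

theorem exists_nsmul_fst_semiconj (A : ℚ) {α : ℚ} (hα : α ≠ 0) :
    ∃ D : ℕ, 0 < D ∧ ∀ B : ℝ, ∀ p ∈ line α B, ∀ n : ℕ,
      D • ((parabolicMap A α)^[n] p).1 =
        D • p.1 + n • ((D * (A / α) * B : ℝ) : UnitAddCircle) := by
  have hα' : (α : ℝ) ≠ 0 := by exact_mod_cast hα
  -- Only the coefficients of `m` and `n` are cleared, so `D` is independent of `B`.
  obtain ⟨D, hD, hk⟩ := exists_common_denominator {A, A / α}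
  refine ⟨D, hD, fun B p hp n => ?_⟩
  obtain ⟨a, ha⟩ := hk A (by simp)
  obtain ⟨b, hb⟩ := hk (A / α) (by simp)
  push_cast at hb
  have hstep : ∀ q ∈ line α B, D • (parabolicMap A α q).1 =
      D • q.1 + ((D * (A / α) * B : ℝ) : UnitAddCircle) := by
    rintro _ ⟨t, rfl⟩
    obtain ⟨i, j, u, hu, h⟩ := parabolicMap_line_point (A := A) hα' B t
    rw [h]
    simp only
    have e : u = t + A / α * B + -(A * i + A / α * j : ℝ) := by
      rw [hu]
      field_simp
      ring
    rw [e, nsmul_coe_add_of_mul_eq_intCast (k := -(a * i + b * j)), AddCircle.coe_add, smul_add,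
      ← AddCircle.coe_nsmul (x := A / α * B), nsmul_eq_mul, mul_assoc]
    push_cast
    rw [← ha, ← hb]
    ring
  induction n with
  | zero => simp
  | succ n ih =>
    rw [Function.iterate_succ_apply', hstep _ ((mapsTo_parabolicMap_line hα' B).iterate n hp), ih,
      succ_nsmul, add_assoc]

theorem length_omegaLimitPt_pos {A α : ℚ} (hA : A ≠ 0) (hα : α ≠ 0) {B : ℝ} (hB : Irrational B)
    {p : Torus} (hp : p ∈ line α B) : 0 < length (omegaLimitPt (parabolicMap A α) p) := by
  obtain ⟨D, hD, h⟩ := exists_nsmul_fst_semiconj A hα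
  refine length_pos_of_nsmul_fst_surjective D hD fun y => ?_
  refine exists_mem_omegaLimitPt_of_mapClusterPt (g := fun q : Torus => D • q.1) (by fun_prop) ?_
  simp only [h B p hp]
  refine mapClusterPt_irrational_rotation ?_ _ _
  have hne : (D : ℚ) * (A / α) ≠ 0 :=
    mul_ne_zero (by exact_mod_cast hD.ne') (div_ne_zero hA hα)
  have := hB.ratCast_mul hne
  push_cast at this
  exact this

theorem finite_nsmul_fiber {E : ℕ} (hE : 0 < E) (p : Torus) : {q : Torus | E • q = E • p}.Finite := by
  have h := AddCircle.finite_torsion (1 : ℝ) hE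
  refine ((h.prod h).preimage (sub_left_injective (b := p)).injOn).subset fun q hq => ?_
  have hz : E • (q - p) = 0 := by
    rw [smul_sub, sub_eq_zero]
    exact hq
  exact ⟨congrArg Prod.fst hz, congrArg Prod.snd hz⟩

theorem eventuallyPeriodic_of_finite {f : Torus → Torus} {p : Torus} {S : Set Torus}
    (hS : S.Finite) (h : ∀ n : ℕ, f^[n] p ∈ S) : EventuallyPeriodic f p := by
  obtain ⟨m, -, n, -, hmn, e⟩ := Set.infinite_univ.exists_lt_map_eq_of_mapsTo
    (fun n _ => h n : Set.MapsTo (fun n : ℕ => f^[n] p) Set.univ S) hS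
  refine ⟨m, n - m, Nat.sub_pos_of_lt hmn, ?_⟩
  rw [Function.IsPeriodicPt, Function.IsFixedPt, ← Function.iterate_add_apply,
    Nat.sub_add_cancel hmn.le]
  exact e.symm

theorem eventuallyPeriodic_parabolicMap {A α : ℚ} (hα : α ≠ 0) (B : ℚ) {p : Torus}
    (hp : p ∈ line α B) : EventuallyPeriodic (parabolicMap A α) p := by
  have hα' : (α : ℝ) ≠ 0 := by exact_mod_cast hα
  -- These are, up to sign, all the coefficients in the displacements of `u` and of `B - α u`.
  obtain ⟨E, hE, hk⟩ := exists_common_denominator {A, A / α, A / α * B, A * B, α * A}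
  obtain ⟨a, ha⟩ := hk A (by simp)
  obtain ⟨b, hb⟩ := hk (A / α) (by simp)
  obtain ⟨c, hc⟩ := hk (A / α * B) (by simp)
  obtain ⟨d, hd⟩ := hk (A * B) (by simp)
  obtain ⟨e, he⟩ := hk (α * A) (by simp)
  push_cast at hb hc hd he
  have hstep : ∀ q ∈ line α B, E • parabolicMap A α q = E • q := by
    rintro _ ⟨t, rfl⟩
    obtain ⟨i, j, u, hu, h⟩ := parabolicMap_line_point (A := A) hα' B t
    rw [h]
    refine Prod.ext ?_ ?_
    · have e₁ : u = t + (A / α * B - A * i - A / α * j : ℝ) := by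
        rw [hu]
        field_simp
      simp only [Prod.smul_fst]
      rw [e₁, nsmul_coe_add_of_mul_eq_intCast (k := c - a * i - b * j)]
      push_cast
      rw [← ha, ← hb, ← hc]
      ring
    · have e₂ : B - α * u = B - α * t + (α * A * i + A * j - A * B : ℝ) := by
        rw [hu]
        field_simp
        ring
      simp only [Prod.smul_snd]
      rw [e₂, nsmul_coe_add_of_mul_eq_intCast (k := e * i + a * j - d)]
      push_cast
      rw [← ha, ← hd, ← he]
      ring
  refine eventuallyPeriodic_of_finite (finite_nsmul_fiber hE p) fun n => ?_
  induction n with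
  | zero => rfl
  | succ n ih =>
    rw [Function.iterate_succ_apply']
    exact (hstep _ ((mapsTo_parabolicMap_line hα' B).iterate n hp)).trans ih

end ParabolicTorus

theorem mainTheorem7 (A α : ℚ) (hA : A ≠ 0) (hα : α ≠ 0) :
    (∀ᵐ B : ℝ ∂volume, ∀ p ∈ ParabolicTorus.line α B,
      ParabolicTorus.omegaLimitPt (ParabolicTorus.parabolicMap A α) p ⊆
          ParabolicTorus.line α B ∧
        0 < ParabolicTorus.length
          (ParabolicTorus.omegaLimitPt (ParabolicTorus.parabolicMap A α) p)) ∧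
    (∀ B : ℚ, ∀ p ∈ ParabolicTorus.line α B,
      ParabolicTorus.EventuallyPeriodic (ParabolicTorus.parabolicMap A α) p) := by
  have hα' : (α : ℝ) ≠ 0 := by exact_mod_cast hα
  have hirr : ∀ᵐ B : ℝ ∂volume, Irrational B :=
    (Set.countable_range ((↑) : ℚ → ℝ)).ae_notMem volume
  refine ⟨?_, fun B p hp => ParabolicTorus.eventuallyPeriodic_parabolicMap hα B hp⟩
  filter_upwards [hirr] with B hB p hp
  exact ⟨ParabolicTorus.omegaLimitPt_subset_of_mapsTo (ParabolicTorus.isClosed_line α B)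
    (ParabolicTorus.mapsTo_parabolicMap_line hα' B) hp,
    ParabolicTorus.length_omegaLimitPt_pos hA hα hB hp⟩
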